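/- Let $X$ be a random vector in $\mathbb R^d$, $M$ a random vector in $\{0,1\}^d$ and $Y$ a real random variable on a common probability space. For $m\in\{0,1\}^d$ put $obs(m)=\{j: m_j=0\}$ and $mis(m)=\{j: m_j=1\}$; subscripts $obs$ and $mis$ denote the corresponding subvectors and blocks, with $m=M$ when $m$ is not displayed. Let $\widetilde X\in(\mathbb R\cup\{\mathtt{NA}\})^d$ be the incomplete vector with $\widetilde X_j=\mathtt{NA}$ if $M_j=1$ and $\widetilde X_j=X_j$ if $M_j=0$; observing $\widetilde X$ is the same as observing $(X_{obs(M)},M)$. Assume: 1. $Y=\beta_0^\star+\langle X,\beta^\star\rangle+\varepsilon$ with $\beta_0^\star\in\mathbb R$, $\beta^\star\in\mathbb R^d$, $\varepsilon\sim\mathcal N(0,\sigma^2)$, $\sigma\ge 0$, and $\varepsilon$ independent of $(X,M)$; 2. $X\sim\mathcal N(\mu,\Sigma)$ with $\Sigma$ positive semidefinite, and $\Sigma_{obs(m)}$ is invertible for every $m$ with $P(M=m)>0$ (for example, $\Sigma$ is positive definite); 3. either (MCAR) $P(M=m\mid X)=P(M=m)$ almost surely for all $m\in\{0,1\}^d$,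 or (MAR) $P(M=m\mid X)=P(M=m\mid X_{obs(m)})$ almost surely for all $m\in\{0,1\}^d$. Then $Y$ is integrable and, almost surely, $$\mathbb E[Y\mid X_{obs},M]=\beta_0^\star+\langle\beta^\star_{obs},X_{obs}\rangle+\big\langle\beta^\star_{mis},\,\mu_{mis}+\Sigma_{mis,obs}\,\Sigma_{obs}^{-1}(X_{obs}-\mu_{obs})\big\rangle .$$ Moreover a Bayes predictor exists, that is, a minimizer $f^\star$ of $\mathbb E[(Y-f(\widetilde X))^2]$ over all measurable $f:(\mathbb R\cup\{\mathtt{NA}\})^d\to\mathbb R$, and for every Bayes predictor $f^\star$, $f^\star(\widetilde X)$ is almost surely equal to the right-hand side above. In particular it is linear within each missingness pattern: for each $m\in\{0,1\}^d$ there are $a\in\mathbb R$ and $b\in\mathbb R^{obs(m)}$ such that every Bayes predictor satisfies $f^\star(\widetilde X)=a+\langle b,X_{obs(m)}\rangle$ almost surely on $\{M=m\}$. -/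

import Mathlib

open MeasureTheory ProbabilityTheory

noncomputable section

namespace MissingData

/-- A missingness pattern `m ∈ {0,1}^d`; `m j = true` means that the coordinate `j` is missing. -/
abbrev Pattern (d : ℕ) : Type := Fin d → Bool

/-- The index set `obs(m)` of the observed coordinates. -/
abbrev Obs {d : ℕ} (m : Pattern d) : Type := {j : Fin d // m j = false}

/-- The index set `mis(m)` of the missing coordinates. -/
abbrev Mis {d : ℕ} (m : Pattern d) : Type := {j : Fin d // m j = true}

/-- The space `(ℝ ∪ {NA})^d` of incomplete vectors (disjoint union, product σ-algebra):
`Sum.inl t` is the observed value `t` and `Sum.inr ()` is the symbol `NA`. -/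
abbrev Incomplete (d : ℕ) : Type := Fin d → ℝ ⊕ Unit

/-- The subvector `x_obs(m)`. -/
def obsPart {d : ℕ} (m : Pattern d) (x : EuclideanSpace ℝ (Fin d)) : Obs m → ℝ :=
  fun j => x j

/-- The subvector `x_mis(m)`. -/
def misPart {d : ℕ} (m : Pattern d) (x : EuclideanSpace ℝ (Fin d)) : Mis m → ℝ :=
  fun j => x j

/-- The incomplete vector obtained from `x` by masking the coordinates that `m` marks as missing. -/
def mask {d : ℕ} (m : Pattern d) (x : EuclideanSpace ℝ (Fin d)) : Incomplete d :=
  fun j => if m j = true then Sum.inr () else Sum.inl (x j)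

/-- The block `Σ_obs(m)`. -/
def obsObs {d : ℕ} (S : Matrix (Fin d) (Fin d) ℝ) (m : Pattern d) : Matrix (Obs m) (Obs m) ℝ :=
  S.submatrix (fun j => j.1) (fun j => j.1)

/-- The block `Σ_{mis(m),obs(m)}`. -/
def misObs {d : ℕ} (S : Matrix (Fin d) (Fin d) ℝ) (m : Pattern d) : Matrix (Mis m) (Obs m) ℝ :=
  S.submatrix (fun j => j.1) (fun j => j.1)

section Mechanisms

variable {Ω : Type*} [MeasurableSpace Ω] {d : ℕ}

/-- Missing completely at random: `P(M = m | X) = P(M = m)` almost surely, for every `m`. -/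
def IsMCAR (P : Measure Ω) (X : Ω → EuclideanSpace ℝ (Fin d)) (M : Ω → Pattern d) : Prop :=
  ∀ m : Pattern d,
    P⟦M ⁻¹' {m} | MeasurableSpace.comap X inferInstance⟧ =ᵐ[P] fun _ => P.real (M ⁻¹' {m})

/-- Missing at random: `P(M = m | X) = P(M = m | X_obs(m))` almost surely, for every `m`. -/
def IsMAR (P : Measure Ω) (X : Ω → EuclideanSpace ℝ (Fin d)) (M : Ω → Pattern d) : Prop :=
  ∀ m : Pattern d,
    P⟦M ⁻¹' {m} | MeasurableSpace.comap X inferInstance⟧ =ᵐ[P]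
      P⟦M ⁻¹' {m} | MeasurableSpace.comap (fun ω => obsPart m (X ω)) inferInstance⟧

/-- The quadratic risk `E[(Y - f(Z))²] ∈ [0, ∞]` of the predictor `f`. -/
def risk {𝒵 : Type*} (P : Measure Ω) (Z : Ω → 𝒵) (Y : Ω → ℝ) (f : 𝒵 → ℝ) : ENNReal :=
  ∫⁻ ω, ENNReal.ofReal ((Y ω - f (Z ω)) ^ 2) ∂P

/-- `f` is a Bayes predictor of `Y` given `Z` for the squared loss: it minimizes the quadratic
risk among all measurable predictors. -/
def IsBayesPredictor {𝒵 : Type*} [MeasurableSpace 𝒵] (P : Measure Ω) (Z : Ω → 𝒵) (Y : Ω → ℝ)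
    (f : 𝒵 → ℝ) : Prop :=
  Measurable f ∧ ∀ g : 𝒵 → ℝ, Measurable g → risk P Z Y f ≤ risk P Z Y g

end Mechanisms

/-- `β₀ + ⟨β_obs, x_obs⟩ + ⟨β_mis, μ_mis + Σ_{mis,obs} Σ_obs⁻¹ (x_obs - μ_obs)⟩`, for the pattern `m`
and the observed values `xobs`. -/
def marFormula {d : ℕ} (β₀ : ℝ) (β μ : EuclideanSpace ℝ (Fin d)) (S : Matrix (Fin d) (Fin d) ℝ)
    (m : Pattern d) (xobs : Obs m → ℝ) : ℝ :=
  β₀ + obsPart m β ⬝ᵥ xobs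
    + misPart m β ⬝ᵥ
      (misPart m μ + Matrix.mulVec (misObs S m * (obsObs S m)⁻¹) (xobs - obsPart m μ))

end MissingData

end

/-! For a fixed pattern `m`, `linear_eq_marFormula_add` splits `Y` into the claimed formula, the
noise, and `β_mis` paired with the residual of the regression of `X_mis` on `X_obs`. The residual is
centred and uncorrelated with `X_obs`, hence independent of it by joint Gaussianity, so its
conditional mean given `X_obs` is zero.

Selecting `{M = m}` may change the law of `X`, but under MAR only through a weight depending on
`X_obs`, so the residual still integrates to zero on `{M = m} ∩ A` for every event `A` of `X_obs`
(`setIntegral_inter_eq_zero`). On `{M = m}` the events of the incomplete vector are exactly of this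
form. Summing over the finitely many patterns, and using independence for the noise, gives the
conditional expectation (`condExp_eq_marPredictor`). MCAR is a special case of MAR. The Bayes
statements follow from the Pythagorean identity `integral_sq_sub_eq`. -/

noncomputable section

namespace MissingData

/-! ### Quadratic risk and conditional expectation. -/

section Bayes

variable {Ω : Type*} [MeasurableSpace Ω] {P : Measure Ω} {𝒵 : Type*} {Z : Ω → 𝒵} {Y : Ω → ℝ}

lemma risk_eq_ofReal {f : 𝒵 → ℝ} (h : MemLp (fun ω => Y ω - f (Z ω)) 2 P) :
    risk P Z Y f = ENNReal.ofReal (∫ ω, (Y ω - f (Z ω)) ^ 2 ∂P) :=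
  (ofReal_integral_eq_lintegral_ofReal h.integrable_sq
    (Filter.Eventually.of_forall fun _ => sq_nonneg _)).symm

variable [MeasurableSpace 𝒵]

/-- Competitors are only measurable; those of finite risk are square integrable, as `f(Z) = Y - (Y -
f(Z))`. -/
lemma memLp_comp_of_risk_ne_top [IsProbabilityMeasure P] (hZ : Measurable Z)
    (hY : MemLp Y 2 P) {f : 𝒵 → ℝ} (hf : Measurable f) (h : risk P Z Y f ≠ ⊤) :
    MemLp (fun ω => f (Z ω)) 2 P := by
  have hfZ : AEStronglyMeasurable (fun ω => f (Z ω)) P := (hf.comp hZ).aestronglyMeasurable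
  have hd : MemLp (fun ω => Y ω - f (Z ω)) 2 P := by
    have hm : AEStronglyMeasurable (fun ω => Y ω - f (Z ω)) P := hY.aestronglyMeasurable.sub hfZ
    rw [memLp_two_iff_integrable_sq hm]
    refine ⟨hm.pow 2, ?_⟩
    rw [hasFiniteIntegral_iff_ofReal (Filter.Eventually.of_forall fun _ => sq_nonneg _)]
    exact lt_of_le_of_ne le_top h
  convert! hY.sub hd using 2 with ω
  simp

/-- Pythagoras: the excess risk of `f` over the regression function `f₀`. -/
lemma integral_sq_sub_eq [IsProbabilityMeasure P] (hZ : Measurable Z) (hY : MemLp Y 2 P)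
    {f₀ f : 𝒵 → ℝ} (hf₀m : Measurable f₀) (hf₀ : MemLp (fun ω => f₀ (Z ω)) 2 P)
    (hE : P[Y | MeasurableSpace.comap Z inferInstance] =ᵐ[P] fun ω => f₀ (Z ω))
    (hfm : Measurable f) (hf : MemLp (fun ω => f (Z ω)) 2 P) :
    ∫ ω, (Y ω - f (Z ω)) ^ 2 ∂P =
      ∫ ω, (Y ω - f₀ (Z ω)) ^ 2 ∂P + ∫ ω, (f₀ (Z ω) - f (Z ω)) ^ 2 ∂P := by
  have hU : MemLp (fun ω => Y ω - f₀ (Z ω)) 2 P := hY.sub hf₀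
  have hV : MemLp (fun ω => f₀ (Z ω) - f (Z ω)) 2 P := hf₀.sub hf
  have hUV : Integrable ((fun ω => Y ω - f₀ (Z ω)) * fun ω => f₀ (Z ω) - f (Z ω)) P :=
    hU.integrable_mul hV
  have hcomap : Measurable[MeasurableSpace.comap Z inferInstance] Z := comap_measurable Z
  have h0m : StronglyMeasurable[MeasurableSpace.comap Z inferInstance] fun ω => f₀ (Z ω) :=
    (hf₀m.comp hcomap).stronglyMeasurable
  have hVm : StronglyMeasurable[MeasurableSpace.comap Z inferInstance]
      fun ω => f₀ (Z ω) - f (Z ω) :=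
    ((hf₀m.comp hcomap).sub (hfm.comp hcomap)).stronglyMeasurable
  have hU0 : P[fun ω => Y ω - f₀ (Z ω) | MeasurableSpace.comap Z inferInstance] =ᵐ[P] 0 := by
    have h1 := condExp_sub (hY.integrable one_le_two) (hf₀.integrable one_le_two)
      (MeasurableSpace.comap Z inferInstance)
    have h2 := condExp_of_stronglyMeasurable hZ.comap_le h0m (hf₀.integrable one_le_two)
    filter_upwards [h1, hE] with ω h1 hE
    refine h1.trans ?_
    simp [h2, hE]
  -- Given `Z`, the factor `f₀(Z) - f(Z)` pulls out and the other has conditional mean zero.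
  have hcross : ∫ ω, (Y ω - f₀ (Z ω)) * (f₀ (Z ω) - f (Z ω)) ∂P = 0 := by
    have h1 := condExp_mul_of_stronglyMeasurable_right hVm hUV (hU.integrable one_le_two)
    have h2 : ∫ ω, ((fun ω => Y ω - f₀ (Z ω)) * fun ω => f₀ (Z ω) - f (Z ω)) ω ∂P = 0 := by
      rw [← integral_condExp hZ.comap_le]
      refine integral_eq_zero_of_ae ?_
      filter_upwards [h1, hU0] with ω h1 hU0
      simp [h1, hU0]
    exact h2
  have : ∀ ω, (Y ω - f (Z ω)) ^ 2 = (Y ω - f₀ (Z ω)) ^ 2 + (f₀ (Z ω) - f (Z ω)) ^ 2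
      + 2 * ((Y ω - f₀ (Z ω)) * (f₀ (Z ω) - f (Z ω))) := fun ω => by ring
  simp_rw [this]
  have h12 : Integrable (fun ω => (Y ω - f₀ (Z ω)) ^ 2 + (f₀ (Z ω) - f (Z ω)) ^ 2) P :=
    hU.integrable_sq.add hV.integrable_sq
  have h3 : Integrable (fun ω => 2 * ((Y ω - f₀ (Z ω)) * (f₀ (Z ω) - f (Z ω)))) P :=
    hUV.const_mul 2
  rw [integral_add h12 h3,
    integral_add hU.integrable_sq hV.integrable_sq, integral_const_mul, hcross]
  simp

lemma isBayesPredictor_of_condExp_eq [IsProbabilityMeasure P] (hZ : Measurable Z)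
    (hY : MemLp Y 2 P) {f₀ : 𝒵 → ℝ} (hf₀m : Measurable f₀)
    (hE : P[Y | MeasurableSpace.comap Z inferInstance] =ᵐ[P] fun ω => f₀ (Z ω)) :
    IsBayesPredictor P Z Y f₀ := by
  have hf₀ : MemLp (fun ω => f₀ (Z ω)) 2 P := (memLp_congr_ae hE).1 (hY.condExp one_le_two)
  refine ⟨hf₀m, fun g hg => ?_⟩
  by_cases hr : risk P Z Y g = ⊤
  · simp [hr]
  have hgL := memLp_comp_of_risk_ne_top hZ hY hg hr
  rw [risk_eq_ofReal (Z := Z) (f := f₀) (hY.sub hf₀),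
    risk_eq_ofReal (Z := Z) (f := g) (hY.sub hgL),
    integral_sq_sub_eq hZ hY hf₀m hf₀ hE hg hgL]
  exact ENNReal.ofReal_le_ofReal
    (le_add_of_nonneg_right (integral_nonneg fun _ => sq_nonneg _))

/-- The excess risk of `f` is its squared L² distance to `f₀` along `Z`, which minimality forces to
vanish. -/
lemma IsBayesPredictor.ae_eq_condExp [IsProbabilityMeasure P] (hZ : Measurable Z)
    (hY : MemLp Y 2 P) {f₀ f : 𝒵 → ℝ} (hf₀m : Measurable f₀)
    (hE : P[Y | MeasurableSpace.comap Z inferInstance] =ᵐ[P] fun ω => f₀ (Z ω))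
    (hf : IsBayesPredictor P Z Y f) :
    ∀ᵐ ω ∂P, f (Z ω) = f₀ (Z ω) := by
  have hf₀ : MemLp (fun ω => f₀ (Z ω)) 2 P := (memLp_congr_ae hE).1 (hY.condExp one_le_two)
  have hle := hf.2 f₀ hf₀m
  have hr₀ := risk_eq_ofReal (Z := Z) (f := f₀) (hY.sub hf₀)
  have hr : risk P Z Y f ≠ ⊤ := ne_top_of_le_ne_top (by rw [hr₀]; exact ENNReal.ofReal_ne_top) hle
  have hfL := memLp_comp_of_risk_ne_top hZ hY hf.1 hr
  rw [hr₀, risk_eq_ofReal (Z := Z) (f := f) (hY.sub hfL),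
    ENNReal.ofReal_le_ofReal_iff (integral_nonneg fun _ => sq_nonneg _),
    integral_sq_sub_eq hZ hY hf₀m hf₀ hE hf.1 hfL] at hle
  have hz : ∫ ω, (f₀ (Z ω) - f (Z ω)) ^ 2 ∂P = 0 :=
    le_antisymm (by linarith) (integral_nonneg fun _ => sq_nonneg _)
  have hd : MemLp (fun ω => f₀ (Z ω) - f (Z ω)) 2 P := hf₀.sub hfL
  rw [integral_eq_zero_iff_of_nonneg (fun _ => sq_nonneg _) hd.integrable_sq] at hz
  filter_upwards [hz] with ω h
  have h' : f₀ (Z ω) - f (Z ω) = 0 := by simpa using h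
  linarith

end Bayes

/-! ### Missingness mechanisms and noise. -/

section Mechanism

variable {Ω : Type*}

lemma measurable_obsPart {d : ℕ} (m : Pattern d) : Measurable (obsPart m) := by
  unfold obsPart; fun_prop

lemma comap_obsPart_le {d : ℕ} (m : Pattern d) (X : Ω → EuclideanSpace ℝ (Fin d)) :
    MeasurableSpace.comap (fun ω => obsPart m (X ω)) inferInstance
      ≤ MeasurableSpace.comap X inferInstance :=
  ((measurable_obsPart m).comp (comap_measurable X)).comap_le

variable [MeasurableSpace Ω] {P : Measure Ω}

/-- Tower property: a constant stays constant when conditioned further on `X_obs`. -/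
lemma IsMCAR.isMAR [IsProbabilityMeasure P] {d : ℕ} {X : Ω → EuclideanSpace ℝ (Fin d)} (hX : Measurable X)
    {M : Ω → Pattern d} (h : IsMCAR P X M) : IsMAR P X M := by
  intro m
  have h1 := condExp_condExp_of_le (μ := P) (f := (M ⁻¹' {m}).indicator fun _ => (1 : ℝ))
    (comap_obsPart_le m X) hX.comap_le
  have h2 := condExp_congr_ae (m := MeasurableSpace.comap (fun ω => obsPart m (X ω)) inferInstance)
    (h m)
  rw [condExp_const ((comap_obsPart_le m X).trans hX.comap_le)] at h2
  exact (h m).trans (h2.symm.trans h1)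

/-- If the conditional probability of `s` given `mX` only depends on `mO`, then a `mX`-measurable
variable whose conditional expectation given `mO` vanishes integrates to zero on `s ∩ A`,
for all `A` in `mO`. -/
lemma setIntegral_inter_eq_zero {Ω : Type*} {mX mO mΩ : MeasurableSpace Ω} {P : Measure Ω}
    [IsProbabilityMeasure P] (hOX : mO ≤ mX) (hX : mX ≤ mΩ)
    {s A : Set Ω} (hs : MeasurableSet[mΩ] s) (hA : MeasurableSet[mO] A)
    (hsX : P⟦s | mX⟧ =ᵐ[P] P⟦s | mO⟧) {W : Ω → ℝ} (hW : Integrable W P)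
    (hWX : StronglyMeasurable[mX] W) (hW0 : P[W | mO] =ᵐ[P] 0) :
    ∫ ω in s ∩ A, W ω ∂P = 0 := by
  have hA' : MeasurableSet[mΩ] A := hX _ (hOX _ hA)
  have hV : Integrable (A.indicator W) P := hW.indicator hA'
  have hVX : StronglyMeasurable[mX] (A.indicator W) := hWX.indicator (hOX _ hA)
  have h1 : Integrable (s.indicator fun _ => (1 : ℝ)) P := (integrable_const 1).indicator hs
  have hprod : (s.indicator fun _ => (1 : ℝ)) * A.indicator W = s.indicator (A.indicator W) := by
    ext ω; by_cases h : ω ∈ s <;> simp [h]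
  have hint : Integrable ((s.indicator fun _ => (1 : ℝ)) * A.indicator W) P := by
    rw [hprod]; exact hV.indicator hs
  -- Conditioning on `mX` turns the indicator of `s` into its `mO`-measurable probability;
  -- conditioning then on `mO` pulls that weight out and leaves the conditional mean of `W`.
  have hX1 := condExp_mul_of_stronglyMeasurable_right hVX hint h1
  have hX2 : P[(s.indicator fun _ => (1 : ℝ)) * A.indicator W | mX] =ᵐ[P]
      P⟦s | mO⟧ * A.indicator W := by
    filter_upwards [hX1, hsX] with ω h1 h2
    simp [h1, h2]
  have hint2 : Integrable (P⟦s | mO⟧ * A.indicator W) P := integrable_condExp.congr hX2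
  have hO1 := condExp_mul_of_stronglyMeasurable_left stronglyMeasurable_condExp hint2 hV
  have hO2 := condExp_indicator hW hA (m := mO)
  calc ∫ ω in s ∩ A, W ω ∂P
      = ∫ ω, ((s.indicator fun _ => (1 : ℝ)) * A.indicator W) ω ∂P := by
        rw [hprod, Set.indicator_indicator, integral_indicator (hs.inter hA')]
    _ = ∫ ω, (P⟦s | mO⟧ * A.indicator W) ω ∂P := by
        rw [← integral_condExp hX, integral_congr_ae hX2]
    _ = 0 := by
        rw [← integral_condExp (hOX.trans hX)]
        refine integral_eq_zero_of_ae ?_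
        filter_upwards [hO1, hO2, hW0] with ω h1 h2 h3
        rw [h1, Pi.mul_apply, h2]
        by_cases h : ω ∈ A <;> simp [h, h3]

lemma setIntegral_eq_zero_of_indepFun {𝒯 : Type*} [MeasurableSpace 𝒯] {ε : Ω → ℝ} {T : Ω → 𝒯}
    (hT : Measurable T) (hε : AEStronglyMeasurable ε P) (hind : IndepFun ε T P)
    (h0 : ∫ ω, ε ω ∂P = 0) {B : Set 𝒯} (hB : MeasurableSet B) :
    ∫ ω in T ⁻¹' B, ε ω ∂P = 0 := by
  have h := (hind.comp measurable_id (measurable_const.indicator hB :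
    Measurable (B.indicator fun _ => (1 : ℝ)))).integral_mul_eq_mul_integral hε
    ((measurable_const.indicator hB).comp hT).aestronglyMeasurable
  rw [Function.id_comp, h0, zero_mul] at h
  rw [← integral_indicator (hT hB), ← h]
  congr 1
  ext ω
  by_cases hω : T ω ∈ B <;> simp [hω]

end Mechanism

/-! ### Gaussian regression of the missing block on the observed one. -/

section Gaussian

variable {d : ℕ}

/-- The residual of the affine regression of `x_mis(m)` on `x_obs(m)`. -/
def regressionResidual (μ : EuclideanSpace ℝ (Fin d)) (S : Matrix (Fin d) (Fin d) ℝ)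
    (m : Pattern d) (x : EuclideanSpace ℝ (Fin d)) : Mis m → ℝ :=
  misPart m x - (misPart m μ
    + Matrix.mulVec (misObs S m * (obsObs S m)⁻¹) (obsPart m x - obsPart m μ))

/-- The linear part of `regressionResidual`. -/
def linearResidual (S : Matrix (Fin d) (Fin d) ℝ) (m : Pattern d)
    (x : EuclideanSpace ℝ (Fin d)) : Mis m → ℝ :=
  misPart m x - Matrix.mulVec (misObs S m * (obsObs S m)⁻¹) (obsPart m x)

/-- The means only contribute a constant shift, so covariance and Gaussianity can be treated on the
linear map. -/
lemma regressionResidual_eq_sub (μ : EuclideanSpace ℝ (Fin d)) (S : Matrix (Fin d) (Fin d) ℝ)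
    (m : Pattern d) (x : EuclideanSpace ℝ (Fin d)) :
    regressionResidual μ S m x = linearResidual S m x - linearResidual S m μ := by
  simp only [regressionResidual, linearResidual, Matrix.mulVec_sub]
  abel

lemma linearResidual_apply (S : Matrix (Fin d) (Fin d) ℝ) (m : Pattern d)
    (x : EuclideanSpace ℝ (Fin d)) (j : Mis m) :
    linearResidual S m x j = x j - ∑ k : Obs m, (misObs S m * (obsObs S m)⁻¹) j k * x k := rfl

lemma measurable_linearResidual (S : Matrix (Fin d) (Fin d) ℝ) (m : Pattern d) :
    Measurable (linearResidual S m) := by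
  refine measurable_pi_lambda _ fun j => ?_
  simp only [linearResidual_apply]
  fun_prop

/-- The linear model splits into the value of `marFormula` and the contribution of the residual. -/
lemma linear_eq_marFormula_add (β₀ : ℝ) (β μ : EuclideanSpace ℝ (Fin d))
    (S : Matrix (Fin d) (Fin d) ℝ) (m : Pattern d) (x : EuclideanSpace ℝ (Fin d)) :
    β₀ + inner ℝ x β = marFormula β₀ β μ S m (obsPart m x)
      + misPart m β ⬝ᵥ regressionResidual μ S m x := by
  have h : inner ℝ x β = obsPart m β ⬝ᵥ obsPart m x + misPart m β ⬝ᵥ misPart m x := by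
    have h1 : misPart m β ⬝ᵥ misPart m x = ∑ j : {j // ¬ m j = false}, β j * x j :=
      Fintype.sum_equiv (Equiv.subtypeEquivRight fun j => by simp) _ _ fun j => rfl
    rw [h1]
    simp only [dotProduct, obsPart]
    rw [Fintype.sum_subtype_add_sum_subtype (fun j => m j = false) fun j => β j * x j]
    simp [PiLp.inner_apply]
  rw [h, marFormula, regressionResidual, dotProduct_sub]
  ring

lemma exists_marFormula_eq (β₀ : ℝ) (β μ : EuclideanSpace ℝ (Fin d))
    (S : Matrix (Fin d) (Fin d) ℝ) (m : Pattern d) :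
    ∃ (a : ℝ) (b : Obs m → ℝ), ∀ x, marFormula β₀ β μ S m x = a + b ⬝ᵥ x := by
  refine ⟨marFormula β₀ β μ S m 0, obsPart m β
    + Matrix.vecMul (misPart m β) (misObs S m * (obsObs S m)⁻¹), fun x => ?_⟩
  simp only [marFormula, Matrix.mulVec_sub, dotProduct_add, dotProduct_sub, add_dotProduct,
    Matrix.dotProduct_mulVec, dotProduct_zero, Matrix.mulVec_zero]
  ring

variable {Ω : Type*} [MeasurableSpace Ω] {P : Measure Ω} {X : Ω → EuclideanSpace ℝ (Fin d)}
  {μ : EuclideanSpace ℝ (Fin d)} {S : Matrix (Fin d) (Fin d) ℝ}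

lemma memLp_eval_of_hasLaw (hXlaw : HasLaw X (multivariateGaussian μ S) P) (j : Fin d) :
    MemLp (fun ω => X ω j) 2 P :=
  (hXlaw.hasGaussianLaw.map_fun (EuclideanSpace.proj j)).memLp_two

lemma integral_eval_of_hasLaw (hXlaw : HasLaw X (multivariateGaussian μ S) P) (j : Fin d) :
    ∫ ω, X ω j ∂P = μ j := by
  have h : ∫ ω, X ω ∂P = μ := by
    rw [hXlaw.integral_eq, integral_id_multivariateGaussian]
  have h2 := (EuclideanSpace.proj j : EuclideanSpace ℝ (Fin d) →L[ℝ] ℝ).integral_comp_comm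
    hXlaw.hasGaussianLaw.integrable
  rw [h] at h2
  exact h2

lemma covariance_eval_of_hasLaw (hS : S.PosSemidef)
    (hXlaw : HasLaw X (multivariateGaussian μ S) P) (i j : Fin d) :
    cov[fun ω => X ω i, fun ω => X ω j; P] = S i j := by
  rw [← covariance_eval_multivariateGaussian (μ := μ) hS i j]
  exact hXlaw.covariance_comp (f := fun x => x i) (g := fun x => x j)
    (Measurable.aemeasurable (by fun_prop)) (Measurable.aemeasurable (by fun_prop))

lemma memLp_linearResidual (hXlaw : HasLaw X (multivariateGaussian μ S) P) (m : Pattern d)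
    (j : Mis m) : MemLp (fun ω => linearResidual S m (X ω) j) 2 P := by
  simp only [linearResidual_apply]
  exact (memLp_eval_of_hasLaw hXlaw j).sub
    (memLp_finsetSum _ fun k _ => (memLp_eval_of_hasLaw hXlaw k).const_mul _)

lemma integral_linearResidual [IsProbabilityMeasure P]
    (hXlaw : HasLaw X (multivariateGaussian μ S) P) (m : Pattern d)
    (j : Mis m) : ∫ ω, linearResidual S m (X ω) j ∂P = linearResidual S m μ j := by
  have hi := fun k => (memLp_eval_of_hasLaw hXlaw k).integrable one_le_two
  have hk : ∀ k : Obs m, Integrable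
      (fun ω => (misObs S m * (obsObs S m)⁻¹) j k * X ω k) P := fun k => (hi k).const_mul _
  simp only [linearResidual_apply]
  rw [integral_sub (hi j) (integrable_finsetSum _ fun k _ => hk k),
    integral_finsetSum _ fun k _ => hk k]
  simp only [integral_const_mul, integral_eval_of_hasLaw hXlaw]

/-- These are the normal equations: the coefficient matrix times `Σ_obs` is `Σ_{mis,obs}`, which is
where invertibility is needed. -/
lemma covariance_linearResidual [IsProbabilityMeasure P] (hS : S.PosSemidef)
    (hXlaw : HasLaw X (multivariateGaussian μ S) P) {m : Pattern d}
    (hinv : IsUnit (obsObs S m)) (i : Obs m) (j : Mis m) :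
    cov[fun ω => X ω i, fun ω => linearResidual S m (X ω) j; P] = 0 := by
  have hL := fun k => memLp_eval_of_hasLaw hXlaw k
  have hsymm : ∀ a b, S a b = S b a := fun a b => by simpa using hS.1.apply b a
  have hk : ∀ k : Obs m, MemLp
      (fun ω => (misObs S m * (obsObs S m)⁻¹) j k * X ω k) 2 P := fun k => (hL k).const_mul _
  simp only [linearResidual_apply]
  rw [covariance_fun_sub_right (hL i) (hL j) (memLp_finsetSum _ fun k _ => hk k),
    covariance_fun_sum_right hk (hL i)]
  simp only [covariance_const_mul_right, covariance_eval_of_hasLaw hS hXlaw]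
  have h : (misObs S m * (obsObs S m)⁻¹ * obsObs S m) j i = misObs S m j i := by
    rw [Matrix.mul_assoc, Matrix.nonsing_inv_mul _ ((Matrix.isUnit_iff_isUnit_det _).1 hinv),
      Matrix.mul_one]
  rw [Matrix.mul_apply] at h
  have h' : ∑ k : Obs m, (misObs S m * (obsObs S m)⁻¹) j k * S i k = S j i := by
    rw [show S j i = misObs S m j i from rfl, ← h]
    exact Finset.sum_congr rfl fun k _ => by rw [hsymm]; rfl
  rw [h', hsymm, sub_self]

/-- Both vectors are components of one linear image of `X`, hence jointly Gaussian, and zero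
covariance gives independence. -/
lemma indepFun_obsPart_linearResidual [IsProbabilityMeasure P] (hS : S.PosSemidef)
    (hXlaw : HasLaw X (multivariateGaussian μ S) P) {m : Pattern d}
    (hinv : IsUnit (obsObs S m)) :
    IndepFun (fun ω => obsPart m (X ω)) (fun ω => linearResidual S m (X ω)) P := by
  let L : EuclideanSpace ℝ (Fin d) →L[ℝ] (Obs m → ℝ) × (Mis m → ℝ) :=
    (ContinuousLinearMap.pi fun i : Obs m => EuclideanSpace.proj (𝕜 := ℝ) i.1).prod
      (ContinuousLinearMap.pi fun j : Mis m => EuclideanSpace.proj (𝕜 := ℝ) j.1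
        - ∑ k : Obs m, (misObs S m * (obsObs S m)⁻¹) j k • EuclideanSpace.proj (𝕜 := ℝ) k.1)
  have hL : HasGaussianLaw
      (fun ω => (fun i : Obs m => X ω i, fun j => linearResidual S m (X ω) j)) P := by
    convert! hXlaw.hasGaussianLaw.map_fun L using 2 with ω
    ext j
    · rfl
    · simp [L, linearResidual_apply]
  exact hL.indepFun_of_covariance_eval (X := fun (i : Obs m) ω => X ω i)
    (Y := fun j ω => linearResidual S m (X ω) j)
    (covariance_linearResidual hS hXlaw hinv)

lemma integrable_dotProduct_regressionResidual [IsProbabilityMeasure P]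
    (hXlaw : HasLaw X (multivariateGaussian μ S) P) (m : Pattern d) (v : Mis m → ℝ) :
    Integrable (fun ω => v ⬝ᵥ regressionResidual μ S m (X ω)) P := by
  simp only [dotProduct, regressionResidual_eq_sub, Pi.sub_apply]
  exact integrable_finsetSum _ fun j _ =>
    (((memLp_linearResidual hXlaw m j).integrable one_le_two).sub (integrable_const _)).const_mul _

lemma integral_dotProduct_regressionResidual [IsProbabilityMeasure P]
    (hXlaw : HasLaw X (multivariateGaussian μ S) P) (m : Pattern d) (v : Mis m → ℝ) :
    ∫ ω, v ⬝ᵥ regressionResidual μ S m (X ω) ∂P = 0 := by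
  have hi := fun j => (memLp_linearResidual hXlaw m j).integrable one_le_two
  have hj : ∀ j : Mis m, Integrable
      (fun ω => v j * (linearResidual S m (X ω) j - linearResidual S m μ j)) P := fun j =>
    ((hi j).sub (integrable_const _)).const_mul _
  simp only [dotProduct, regressionResidual_eq_sub, Pi.sub_apply]
  rw [integral_finsetSum _ fun j _ => hj j]
  refine Finset.sum_eq_zero fun j _ => ?_
  rw [integral_const_mul, integral_sub (hi j) (integrable_const _),
    integral_linearResidual hXlaw]
  simp

lemma measurable_dotProduct_regressionResidual (μ : EuclideanSpace ℝ (Fin d))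
    (S : Matrix (Fin d) (Fin d) ℝ) (m : Pattern d) (v : Mis m → ℝ) :
    Measurable fun x => v ⬝ᵥ regressionResidual μ S m x := by
  have h := fun j => (measurable_pi_apply j).comp (measurable_linearResidual S m)
  simp only [dotProduct, regressionResidual_eq_sub, Pi.sub_apply]
  exact Finset.measurable_sum _ fun j _ => ((h j).sub_const _).const_mul _

lemma condExp_dotProduct_regressionResidual [IsProbabilityMeasure P] (hX : Measurable X)
    (hS : S.PosSemidef) (hXlaw : HasLaw X (multivariateGaussian μ S) P) {m : Pattern d}
    (hinv : IsUnit (obsObs S m)) (v : Mis m → ℝ) :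
    P[fun ω => v ⬝ᵥ regressionResidual μ S m (X ω) |
      MeasurableSpace.comap (fun ω => obsPart m (X ω)) inferInstance] =ᵐ[P] 0 := by
  have hW : Measurable fun ω => v ⬝ᵥ regressionResidual μ S m (X ω) :=
    (measurable_dotProduct_regressionResidual μ S m v).comp hX
  have hind : IndepFun (fun ω => v ⬝ᵥ regressionResidual μ S m (X ω))
      (fun ω => obsPart m (X ω)) P := by
    have hφ : Measurable fun r : Mis m → ℝ => v ⬝ᵥ (r - linearResidual S m μ) := by
      simp only [dotProduct, Pi.sub_apply]
      fun_prop
    simp only [regressionResidual_eq_sub]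
    exact ((indepFun_obsPart_linearResidual hS hXlaw hinv).comp measurable_id hφ).symm
  have h := condExp_indep_eq hW.comap_le ((measurable_obsPart m).comp hX).comap_le
    (comap_measurable _).stronglyMeasurable hind
  rw [integral_dotProduct_regressionResidual hXlaw] at h
  exact h

end Gaussian

/-! ### Incomplete vectors and measurability. -/

section Mask

variable {d : ℕ}

/-- The missingness pattern of an incomplete vector. -/
def patternOf (z : Incomplete d) : Pattern d := fun j => (z j).isRight

/-- The values of an incomplete vector, with `NA` replaced by zero. -/
def valuesOf (z : Incomplete d) : EuclideanSpace ℝ (Fin d) :=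
  WithLp.toLp 2 fun j => Sum.elim id (fun _ => 0) (z j)

lemma measurable_patternOf : Measurable (patternOf (d := d)) := by
  refine measurable_pi_lambda _ fun j => ?_
  have h : Measurable (Sum.isRight : ℝ ⊕ Unit → Bool) :=
    measurable_fun_sum measurable_const measurable_const
  exact h.comp (measurable_pi_apply j)

lemma measurable_valuesOf : Measurable (valuesOf (d := d)) := by
  have h : Measurable (Sum.elim id (fun _ => 0) : ℝ ⊕ Unit → ℝ) :=
    measurable_fun_sum measurable_id measurable_const
  have h2 : Measurable fun (z : Incomplete d) (j : Fin d) =>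
      (Sum.elim id (fun _ => 0) : ℝ ⊕ Unit → ℝ) (z j) :=
    measurable_pi_lambda _ fun j => h.comp (measurable_pi_apply j)
  exact (WithLp.measurable_toLp 2 _).comp h2

lemma patternOf_mask (m : Pattern d) (x : EuclideanSpace ℝ (Fin d)) :
    patternOf (mask m x) = m := by
  ext j
  cases h : m j <;> simp [patternOf, mask, h]

/-- The zero put in place of `NA` is harmless, as only observed coordinates are read. -/
lemma obsPart_valuesOf_mask (m : Pattern d) (x : EuclideanSpace ℝ (Fin d)) :
    obsPart m (valuesOf (mask m x)) = obsPart m x := by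
  ext j
  simp [obsPart, valuesOf, mask, j.2]

/-- The incomplete vector with pattern `m` and observed values `y`. -/
def ofObs (m : Pattern d) (y : Obs m → ℝ) : Incomplete d :=
  fun j => if h : m j = false then Sum.inl (y ⟨j, h⟩) else Sum.inr ()

/-- For a fixed pattern, masking factors through the observed part; this turns events of the
incomplete vector into events of `X_obs`. -/
lemma mask_eq_ofObs (m : Pattern d) (x : EuclideanSpace ℝ (Fin d)) :
    mask m x = ofObs m (obsPart m x) := by
  ext j : 1
  cases h : m j <;> simp [mask, ofObs, obsPart, h]

lemma measurable_ofObs (m : Pattern d) : Measurable (ofObs m) := by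
  refine measurable_pi_lambda _ fun j => ?_
  by_cases h : m j = false
  · simp only [ofObs, h, dite_true]
    exact measurable_inl.comp (measurable_pi_apply _)
  · simp only [ofObs, h]
    exact measurable_const

/-- There are countably many patterns, so measurability for each fixed one suffices. -/
lemma measurable_mask : Measurable fun p : Pattern d × EuclideanSpace ℝ (Fin d) =>
    mask p.1 p.2 :=
  measurable_from_prod_countable_right fun m => by
    simp only [mask_eq_ofObs]
    exact (measurable_ofObs m).comp (measurable_obsPart m)

/-- `marFormula` as a function of the incomplete vector. -/
def marPredictor (β₀ : ℝ) (β μ : EuclideanSpace ℝ (Fin d)) (S : Matrix (Fin d) (Fin d) ℝ)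
    (z : Incomplete d) : ℝ :=
  marFormula β₀ β μ S (patternOf z) (obsPart (patternOf z) (valuesOf z))

lemma marPredictor_mask (β₀ : ℝ) (β μ : EuclideanSpace ℝ (Fin d))
    (S : Matrix (Fin d) (Fin d) ℝ) (m : Pattern d) (x : EuclideanSpace ℝ (Fin d)) :
    marPredictor β₀ β μ S (mask m x) = marFormula β₀ β μ S m (obsPart m x) := by
  rw [marPredictor, patternOf_mask, obsPart_valuesOf_mask]

lemma measurable_marPredictor (β₀ : ℝ) (β μ : EuclideanSpace ℝ (Fin d))
    (S : Matrix (Fin d) (Fin d) ℝ) : Measurable (marPredictor β₀ β μ S) := by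
  have h : Measurable fun p : Pattern d × EuclideanSpace ℝ (Fin d) =>
      marFormula β₀ β μ S p.1 (obsPart p.1 p.2) := by
    refine measurable_from_prod_countable_right fun m => ?_
    obtain ⟨a, b, hab⟩ := exists_marFormula_eq β₀ β μ S m
    simp only [hab, dotProduct, obsPart]
    fun_prop
  exact h.comp (measurable_patternOf.prodMk measurable_valuesOf)

end Mask

/-! ### The conditional expectation and the main theorem. -/

theorem condExp_eq_marPredictor {Ω : Type*} [MeasurableSpace Ω] {P : Measure Ω}
    [IsProbabilityMeasure P] {d : ℕ}
    {X : Ω → EuclideanSpace ℝ (Fin d)} (hX : Measurable X)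
    {M : Ω → Pattern d} (hM : Measurable M) {ε Y : Ω → ℝ}
    {β₀ : ℝ} {β : EuclideanSpace ℝ (Fin d)}
    (hY : ∀ᵐ ω ∂P, Y ω = β₀ + inner ℝ (X ω) β + ε ω)
    (hε : Integrable ε P) (hε0 : ∫ ω, ε ω ∂P = 0)
    (hind : IndepFun ε (fun ω => (X ω, M ω)) P)
    {μ : EuclideanSpace ℝ (Fin d)} {S : Matrix (Fin d) (Fin d) ℝ} (hS : S.PosSemidef)
    (hXlaw : HasLaw X (multivariateGaussian μ S) P)
    (hinv : ∀ m : Pattern d, P (M ⁻¹' {m}) ≠ 0 → IsUnit (obsObs S m))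
    (hmech : IsMAR P X M) (hYint : Integrable Y P) :
    P[Y | MeasurableSpace.comap (fun ω => mask (M ω) (X ω)) inferInstance] =ᵐ[P]
      fun ω => marPredictor β₀ β μ S (mask (M ω) (X ω)) := by
  have hZ : Measurable fun ω => mask (M ω) (X ω) := measurable_mask.comp (hM.prodMk hX)
  have hMm : ∀ m, MeasurableSet (M ⁻¹' {m}) := fun m => hM (measurableSet_singleton m)
  have hW := fun m : Pattern d => integrable_dotProduct_regressionResidual hXlaw m (misPart m β)
  -- The residual for the random pattern, written as a finite sum so that each fixed pattern is
  -- handled separately.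
  let R : Ω → ℝ := fun ω => ∑ m : Pattern d, (M ⁻¹' {m}).indicator
    (fun ω => misPart m β ⬝ᵥ regressionResidual μ S m (X ω)) ω
  have hRint : Integrable R P :=
    integrable_finsetSum _ fun m _ => (hW m).indicator (hMm m)
  have hR : ∀ ω, R ω = misPart (M ω) β ⬝ᵥ regressionResidual μ S (M ω) (X ω) := fun ω => by
    simp only [R]
    rw [Finset.sum_eq_single (M ω)]
    · simp
    · intro m _ hm
      exact Set.indicator_of_notMem (by simpa using hm.symm) _
    · simp
  have hdec : ∀ᵐ ω ∂P, marPredictor β₀ β μ S (mask (M ω) (X ω)) = Y ω - (ε ω + R ω) := by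
    filter_upwards [hY] with ω h
    rw [marPredictor_mask, h, hR, linear_eq_marFormula_add β₀ β μ S (M ω)]
    ring
  have hGint : Integrable (fun ω => marPredictor β₀ β μ S (mask (M ω) (X ω))) P :=
    (hYint.sub (hε.add hRint)).congr (hdec.mono fun ω h => h.symm)
  refine (ae_eq_condExp_of_forall_setIntegral_eq hZ.comap_le hYint
    (fun _ _ _ => hGint.integrableOn) ?_
    ((measurable_marPredictor β₀ β μ S).comp
      (comap_measurable _)).stronglyMeasurable.aestronglyMeasurable).symm
  rintro _ ⟨C, hC, rfl⟩ -
  have hT : MeasurableSet ((fun ω => mask (M ω) (X ω)) ⁻¹' C) := hZ hC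
  have hε' : ∫ ω in (fun ω => mask (M ω) (X ω)) ⁻¹' C, ε ω ∂P = 0 :=
    setIntegral_eq_zero_of_indepFun (hX.prodMk hM) hε.aestronglyMeasurable hind hε0
      (measurable_mask.comp measurable_swap hC)
  have hR' : ∫ ω in (fun ω => mask (M ω) (X ω)) ⁻¹' C, R ω ∂P = 0 := by
    simp only [R]
    rw [integral_finsetSum _ fun m _ => ((hW m).indicator (hMm m)).integrableOn]
    refine Finset.sum_eq_zero fun m _ => ?_
    rw [integral_indicator (hMm m), Measure.restrict_restrict (hMm m)]
    -- Invertibility of `Σ_obs(m)` is available only for patterns of positive probability; the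
    -- others contribute nothing.
    by_cases hm : P (M ⁻¹' {m}) = 0
    · exact setIntegral_measure_zero _ (measure_mono_null Set.inter_subset_left hm)
    have hset : M ⁻¹' {m} ∩ (fun ω => mask (M ω) (X ω)) ⁻¹' C
        = M ⁻¹' {m} ∩ (fun ω => obsPart m (X ω)) ⁻¹' (ofObs m ⁻¹' C) := by
      ext ω
      simp only [Set.mem_inter_iff, Set.mem_preimage, Set.mem_singleton_iff]
      refine and_congr_right fun h => ?_
      rw [h, mask_eq_ofObs]
    rw [hset]
    exact setIntegral_inter_eq_zero (comap_obsPart_le m X) hX.comap_le (hMm m)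
      ⟨_, measurable_ofObs m hC, rfl⟩ (hmech m) (hW m)
      ((measurable_dotProduct_regressionResidual μ S m _).comp
        (comap_measurable X)).stronglyMeasurable
      (condExp_dotProduct_regressionResidual hX hS hXlaw (hinv m hm) _)
  have hεR : Integrable (fun ω => ε ω + R ω) P := hε.add hRint
  rw [setIntegral_congr_ae hT (hdec.mono fun ω h _ => h),
    integral_sub hYint.integrableOn hεR.integrableOn,
    integral_add hε.integrableOn hRint.integrableOn, hε', hR']
  simp

end MissingData

end

theorem proposition2p1 {Ω : Type*} [MeasurableSpace Ω] (P : Measure Ω) [IsProbabilityMeasure P]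
    (d : ℕ)
    (X : Ω → EuclideanSpace ℝ (Fin d)) (hX : Measurable X)
    (M : Ω → MissingData.Pattern d) (hM : Measurable M)
    (ε Y : Ω → ℝ)
    -- linear model with Gaussian noise, independent of the covariates and of the mask
    (β₀ : ℝ) (β : EuclideanSpace ℝ (Fin d)) (σ : NNReal)
    (hY : ∀ᵐ ω ∂P, Y ω = β₀ + inner ℝ (X ω) β + ε ω)
    (hε : HasLaw ε (gaussianReal 0 (σ ^ 2)) P)
    (hind : IndepFun ε (fun ω => (X ω, M ω)) P)
    -- Gaussian covariates; the observed covariance blocks that occur are invertible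
    (μ : EuclideanSpace ℝ (Fin d)) (S : Matrix (Fin d) (Fin d) ℝ) (hS : S.PosSemidef)
    (hXlaw : HasLaw X (multivariateGaussian μ S) P)
    (hinv : ∀ m : MissingData.Pattern d, P (M ⁻¹' {m}) ≠ 0 → IsUnit (MissingData.obsObs S m))
    -- missingness mechanism
    (hmech : MissingData.IsMCAR P X M ∨ MissingData.IsMAR P X M) :
    -- the conditional expectation `E[Y | X_obs(M), M]`
    (Integrable Y P ∧
      P[Y | MeasurableSpace.comap (fun ω => MissingData.mask (M ω) (X ω)) inferInstance] =ᵐ[P]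
        fun ω => MissingData.marFormula β₀ β μ S (M ω) (MissingData.obsPart (M ω) (X ω))) ∧
    -- the minimizers of the quadratic risk
    (∃ f : MissingData.Incomplete d → ℝ,
      MissingData.IsBayesPredictor P (fun ω => MissingData.mask (M ω) (X ω)) Y f) ∧
    (∀ f : MissingData.Incomplete d → ℝ,
      MissingData.IsBayesPredictor P (fun ω => MissingData.mask (M ω) (X ω)) Y f →
        ∀ᵐ ω ∂P, f (MissingData.mask (M ω) (X ω)) =
          MissingData.marFormula β₀ β μ S (M ω) (MissingData.obsPart (M ω) (X ω))) ∧
    -- linearity within each missingness pattern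
    (∀ m : MissingData.Pattern d, ∃ (a : ℝ) (b : MissingData.Obs m → ℝ),
      ∀ f : MissingData.Incomplete d → ℝ,
        MissingData.IsBayesPredictor P (fun ω => MissingData.mask (M ω) (X ω)) Y f →
          ∀ᵐ ω ∂P, M ω = m →
            f (MissingData.mask (M ω) (X ω)) = a + b ⬝ᵥ MissingData.obsPart m (X ω)) := by
  have hZ : Measurable fun ω => MissingData.mask (M ω) (X ω) :=
    MissingData.measurable_mask.comp (hM.prodMk hX)
  have hεL : MemLp ε 2 P := hε.hasGaussianLaw.memLp_two
  have hXβ : MemLp (fun ω => inner ℝ (X ω) β) 2 P :=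
    hXlaw.hasGaussianLaw.memLp_two.inner_const β
  have hYL : MemLp Y 2 P :=
    (memLp_congr_ae hY).2 (((memLp_const β₀).add hXβ).add hεL)
  have hε0 : ∫ ω, ε ω ∂P = 0 := by rw [hε.integral_eq, integral_id_gaussianReal]
  have hE := MissingData.condExp_eq_marPredictor hX hM hY (hεL.integrable one_le_two) hε0 hind hS
    hXlaw hinv (hmech.elim (fun h => h.isMAR hX) id) (hYL.integrable one_le_two)
  have hm := MissingData.measurable_marPredictor β₀ β μ S
  have hB : ∀ f : MissingData.Incomplete d → ℝ,
      MissingData.IsBayesPredictor P (fun ω => MissingData.mask (M ω) (X ω)) Y f →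
        ∀ᵐ ω ∂P, f (MissingData.mask (M ω) (X ω)) =
          MissingData.marFormula β₀ β μ S (M ω) (MissingData.obsPart (M ω) (X ω)) := by
    intro f hf
    simpa only [MissingData.marPredictor_mask] using hf.ae_eq_condExp hZ hYL hm hE
  refine ⟨⟨hYL.integrable one_le_two, ?_⟩,
    ⟨_, MissingData.isBayesPredictor_of_condExp_eq hZ hYL hm hE⟩, hB, fun m => ?_⟩
  · simpa only [MissingData.marPredictor_mask] using hE
  · obtain ⟨a, b, hab⟩ := MissingData.exists_marFormula_eq β₀ β μ S m
    refine ⟨a, b, fun f hf => ?_⟩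
    filter_upwards [hB f hf] with ω h hω
    rw [h, hω, hab]
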